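/- Let $\mathcal X\subset\mathbb R^d$ be a set on which gradients are well defined (unique differentials at every point of $\mathcal X$; e.g. $\mathbb R^d$, an open set, or a convex set with non-empty interior), let $\mathcal Y$ be a measurable space (e.g. a subset of a Euclidean space), $\ell:\mathcal Y\times\mathcal Y\to\mathbb R$ a loss, $d_x:\mathcal X\times\mathcal X\to\mathbb R$ a fair metric (no metric axioms are needed), $\lambda\in\mathbb R$ and $T>0$. For a model $f:\mathcal X\to\mathcal Y$ and a sample $(x_0,y_0)\in\mathcal X\times\mathcal Y$, the gradient flow attack is the problem $$\dot X(t)=\nabla_x\{\ell(f(x),y_0)-\lambda d_x^2(x,x_0)\}\big|_{x=X(t)},\qquad X(0)=x_0,\qquad 0\le t\le T,$$ for a path in $\mathcal X$; the unfair map is $\Phi_f(x_0,y_0)=X(T)$, and the loss ratio is $r_f(x,y)=\ell(f(\Phi_f(x,y)),y)/\ell(f(x),y)$. Let $P$ be a probability distribution on $\mathcal X\times\mathcal Y$, let $(x_i,y_i)_{i\ge1}$ be i.i.d. with law $P$, and let $f$ be a (possibly random) model drawn from a measurably parametrized class of models and independent of $(x_i,y_i)_{i\ge 1}$. Assume that for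 almost every realization of $f$: (i) for every $(x_0,y_0)\in\mathcal X\times\mathcal Y$ the function $x\mapsto \ell(f(x),y_0)-\lambda d_x^2(x,x_0)$ is differentiable on $\mathcal X$ and its gradient is Lipschitz in $x\in\mathcal X$ for the Euclidean norm; if $\mathcal X\neq\mathbb R^d$, assume also that the gradient flow attack does not leave $\mathcal X$ up to time $T$, that is, it has a solution path in $\mathcal X$ on $[0,T]$ from every sample; (ii) $\ell(f(x),y)\ne0$ for $P$-almost every $(x,y)$, and $r_f$ has finite first and second moments and non-zero variance under $P$ ($r_f(x,y)$ being jointly measurable in $f$ and $(x,y)$). Let $$S_n=\frac1n\sum_{i=1}^n r_f(x_i,y_i),\qquad V_n^2=\frac1{n-1}\sum_{i=1}^n\big(r_f(x_i,y_i)-S_n\big)^2 .$$ Then, for almost every realization of $f$, the gradient flow attack has exactly one solution path on $[0,T]$ from every sample, so that $\Phi_f$ is well defined on $\mathcal X\times\mathcal Y$, and $$\sqrt n\,V_n^{-1}\big(S_n-\mathbb E_P[r_f]\big)\ \xrightarrow{d}\ \mathcal N(0,1)\qquad(n\to\infty),$$ where $\mathbb E_P[r_f]$ is the expectation over $(x,y)\sim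 P$ with $f$ held fixed, and the statistic is given the value $0$ when $V_n=0$. -/

import Mathlib

open MeasureTheory ProbabilityTheory Filter Set
open scoped NNReal Topology

noncomputable section

/-- The regularized loss `x ↦ ℓ(f(x), y₀) - λ d_x²(x, x₀)` attached to a model `f` and a sample
`z₀ = (x₀, y₀)`. -/
def regLoss {d : ℕ} {Y : Type*} (ℓ : Y → Y → ℝ)
    (dX : EuclideanSpace ℝ (Fin d) → EuclideanSpace ℝ (Fin d) → ℝ) (lam : ℝ)
    (f : EuclideanSpace ℝ (Fin d) → Y) (z₀ : EuclideanSpace ℝ (Fin d) × Y)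
    (x : EuclideanSpace ℝ (Fin d)) : ℝ :=
  ℓ (f x) z₀.2 - lam * dX x z₀.1 ^ 2

/-- The function `R` has a gradient at all points of the feature space `X`, and the gradient is
Lipschitz on `X` for the Euclidean norm.  Only the values of `R` on `X` matter. -/
def HasLipschitzGradientOn {d : ℕ} (R : EuclideanSpace ℝ (Fin d) → ℝ)
    (X : Set (EuclideanSpace ℝ (Fin d))) : Prop :=
  DifferentiableOn ℝ R X ∧ ∃ L : ℝ≥0, LipschitzOnWith L (gradientWithin R X) X

/-- `γ` is a solution path, in the feature space `X` and over the time interval `[0, T]`, of the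
gradient flow `γ'(t) = ∇R(γ(t))`, `γ(0) = x₀`. -/
structure IsGradientFlowOn {d : ℕ} (X : Set (EuclideanSpace ℝ (Fin d)))
    (R : EuclideanSpace ℝ (Fin d) → ℝ) (T : ℝ) (x₀ : EuclideanSpace ℝ (Fin d))
    (γ : ℝ → EuclideanSpace ℝ (Fin d)) : Prop where
  initial : γ 0 = x₀
  mem : ∀ t ∈ Icc 0 T, γ t ∈ X
  ode : ∀ t ∈ Icc 0 T, HasDerivWithinAt γ (gradientWithin R X (γ t)) (Icc 0 T) t

open Classical in
/-- The unfair map `Φ(x₀, y₀) = γ(T)`, where `γ` solves the gradient flow attack started from the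
sample `z₀ = (x₀, y₀)`.  (The value `x₀` is used if there is no solution.) -/
def unfairMap {d : ℕ} {Y : Type*} (X : Set (EuclideanSpace ℝ (Fin d))) (ℓ : Y → Y → ℝ)
    (dX : EuclideanSpace ℝ (Fin d) → EuclideanSpace ℝ (Fin d) → ℝ) (lam T : ℝ)
    (f : EuclideanSpace ℝ (Fin d) → Y) (z₀ : EuclideanSpace ℝ (Fin d) × Y) :
    EuclideanSpace ℝ (Fin d) :=
  if h : ∃ γ, IsGradientFlowOn X (regLoss ℓ dX lam f z₀) T z₀.1 γ then h.choose T else z₀.1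

/-- The loss ratio `ℓ(f(Φ(x, y)), y) / ℓ(f(x), y)`. -/
def lossRatio {d : ℕ} {Y : Type*} (X : Set (EuclideanSpace ℝ (Fin d))) (ℓ : Y → Y → ℝ)
    (dX : EuclideanSpace ℝ (Fin d) → EuclideanSpace ℝ (Fin d) → ℝ) (lam T : ℝ)
    (f : EuclideanSpace ℝ (Fin d) → Y) (z : EuclideanSpace ℝ (Fin d) × Y) : ℝ :=
  ℓ (f (unfairMap X ℓ dX lam T f z)) z.2 / ℓ (f z.1) z.2

/-- The empirical mean `S_n = (1/n) ∑ r(z_i)` of `r` over the first `n` data points. -/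
def empMean {Z : Type*} (r : Z → ℝ) (z : ℕ → Z) (n : ℕ) : ℝ :=
  (1 / (n : ℝ)) * ∑ i ∈ Finset.range n, r (z i)

/-- The empirical variance `V_n² = (1/(n-1)) ∑ (r(z_i) - S_n)²` over the first `n` data points. -/
def empVar {Z : Type*} (r : Z → ℝ) (z : ℕ → Z) (n : ℕ) : ℝ :=
  (1 / ((n : ℝ) - 1)) * ∑ i ∈ Finset.range n, (r (z i) - empMean r z n) ^ 2

/-- The studentized mean `√n V_n⁻¹ (S_n - E_P[r])`. -/
def studentizedMean {Z : Type*} [MeasurableSpace Z] (P : Measure Z) (r : Z → ℝ) (z : ℕ → Z)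
    (n : ℕ) : ℝ :=
  √(n : ℝ) * (√(empVar r z n))⁻¹ * (empMean r z n - ∫ w, r w ∂P)

end

/-! A Lipschitz gradient gives uniqueness of the attack path by Grönwall (`IsGradientFlowOn.eqOn`).
Existence on all of `ℝᵈ` is global Picard-Lindelöf, obtained by gluing short solutions of uniform
duration; on other feature spaces it is the hypothesis `hStay`.

For a fixed model the loss ratios of the data are i.i.d. with finite positive variance, so the
classical CLT, strong consistency of the empirical variance and Slutsky's lemma give the limit `N(0,
1)`. This limit does not depend on the model. Independence and Fubini therefore write the
expectation of a bounded continuous test function as an average over models, and dominated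
convergence passes to the limit (`tendstoInDistribution_of_ae_of_indepFun`). -/

/-- Solutions of an autonomous differential equation can be concatenated. -/
lemma exists_integralCurve_concat {E : Type*} [NormedAddCommGroup E] [NormedSpace ℝ E]
    {v : E → E} {a b : ℝ} (ha : 0 ≤ a) (hb : 0 ≤ b) {γ₁ γ₂ : ℝ → E}
    (h₁ : ∀ t ∈ Icc 0 a, HasDerivWithinAt γ₁ (v (γ₁ t)) (Icc 0 a) t)
    (h₂ : ∀ t ∈ Icc 0 b, HasDerivWithinAt γ₂ (v (γ₂ t)) (Icc 0 b) t) (h₁₂ : γ₂ 0 = γ₁ a) :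
    ∃ γ : ℝ → E, γ 0 = γ₁ 0 ∧
      ∀ t ∈ Icc 0 (a + b), HasDerivWithinAt γ (v (γ t)) (Icc 0 (a + b)) t := by
  let γ : ℝ → E := fun t => if t ≤ a then γ₁ t else γ₂ (t - a)
  have hγ₁ : ∀ t ∈ Icc 0 a, γ t = γ₁ t := fun t ht => if_pos ht.2
  have hγ₂ : ∀ t ∈ Icc a (a + b), γ t = γ₂ (t - a) := fun t ht => by
    rcases ht.1.eq_or_lt with rfl | h
    · simp [γ, h₁₂]
    · exact if_neg h.not_ge
  refine ⟨γ, hγ₁ 0 ⟨le_rfl, ha⟩, fun t _ => ?_⟩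
  have hU : Icc 0 (a + b) = Icc 0 a ∪ Icc a (a + b) :=
    (Icc_union_Icc_eq_Icc ha (by linarith)).symm
  rw [hU]
  refine HasDerivWithinAt.union ?_ ?_
  · by_cases ht : t ∈ Icc 0 a
    · rw [hγ₁ t ht]
      exact (h₁ t ht).congr hγ₁ (hγ₁ t ht)
    -- Away from the closed piece, differentiability within it is vacuous.
    · exact HasFDerivWithinAt.of_notMem_closure (by rwa [isClosed_Icc.closure_eq])
  · by_cases ht : t ∈ Icc a (a + b)
    · rw [hγ₂ t ht]
      refine HasDerivWithinAt.congr ?_ hγ₂ (hγ₂ t ht)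
      have hm : MapsTo (fun s => s - a) (Icc a (a + b)) (Icc 0 b) := fun s hs =>
        ⟨by linarith [hs.1], by linarith [hs.2]⟩
      simpa [Function.comp_def] using (h₂ (t - a) (hm ht)).scomp t
        ((hasDerivWithinAt_id t _).sub_const a) hm
    · exact HasFDerivWithinAt.of_notMem_closure (by rwa [isClosed_Icc.closure_eq])

namespace LipschitzWith

variable {E : Type*} [NormedAddCommGroup E] [NormedSpace ℝ E] [CompleteSpace E]
  {K : ℝ≥0} {v : E → E}

/-- A globally Lipschitz vector field has solutions on an interval whose length does not depend on
the initial value. -/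
lemma exists_integralCurve_short (hv : LipschitzWith K v) (x : E) :
    ∃ γ : ℝ → E, γ 0 = x ∧ ∀ t ∈ Icc 0 (1 / (2 * ((K : ℝ) + 1))),
      HasDerivWithinAt γ (v (γ t)) (Icc 0 (1 / (2 * ((K : ℝ) + 1)))) t := by
  have hh : (0 : ℝ) ≤ 1 / (2 * ((K : ℝ) + 1)) := by positivity
  -- On the ball of radius `‖v x‖` about `x` the speed is at most `(K + 1) * ‖v x‖`, so the
  -- displacement is at most `‖v x‖ / 2`. Scaling the radius with `‖v x‖` makes the duration
  -- independent of `x`.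
  have hpl : IsPicardLindelof (fun _ => v)
      (⟨0, left_mem_Icc.2 hh⟩ : Icc (0 : ℝ) (1 / (2 * ((K : ℝ) + 1)))) x ‖v x‖₊ 0
      ((K + 1) * ‖v x‖₊) K := by
    refine .of_time_independent (fun y hy => ?_) hv.lipschitzOnWith ?_
    · have h1 := hv.dist_le_mul y x
      rw [Metric.mem_closedBall] at hy
      have h2 : (K : ℝ) * dist y x ≤ K * ‖v x‖ := by gcongr; simpa using hy
      have h3 : ‖v y‖ ≤ ‖v y - v x‖ + ‖v x‖ := by simpa using norm_add_le (v y - v x) (v x)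
      rw [dist_eq_norm] at h1
      push_cast
      linarith
    · have hK : (K : ℝ) + 1 ≠ 0 := by positivity
      simp only [sub_zero, max_eq_left hh, NNReal.coe_mul, NNReal.coe_add,
        NNReal.coe_one, coe_nnnorm, NNReal.coe_zero]
      have : ((K : ℝ) + 1) * ‖v x‖ * (1 / (2 * ((K : ℝ) + 1))) = ‖v x‖ / 2 := by field_simp
      rw [this]
      linarith [norm_nonneg (v x)]
  simpa using hpl.exists_eq_forall_mem_Icc_hasDerivWithinAt₀

/-- **Global Picard-Lindelöf theorem**: a globally Lipschitz vector field has solutions on all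
compact intervals. -/
theorem exists_integralCurve (hv : LipschitzWith K v) (x : E) (T : ℝ) :
    ∃ γ : ℝ → E, γ 0 = x ∧ ∀ t ∈ Icc 0 T, HasDerivWithinAt γ (v (γ t)) (Icc 0 T) t := by
  set h : ℝ := 1 / (2 * ((K : ℝ) + 1)) with hh
  have hpos : 0 < h := by positivity
  have key : ∀ n : ℕ, ∃ γ : ℝ → E, γ 0 = x ∧
      ∀ t ∈ Icc 0 (n * h), HasDerivWithinAt γ (v (γ t)) (Icc 0 (n * h)) t := by
    intro n
    induction n with
    | zero =>
      refine ⟨fun _ => x, rfl, fun t _ => ?_⟩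
      have hs : (Icc (0 : ℝ) ((0 : ℕ) * h)).Subsingleton := by simp
      exact HasFDerivWithinAt.of_subsingleton hs
    | succ n ih =>
      obtain ⟨γ₁, h0, h₁⟩ := ih
      obtain ⟨γ₂, h0', h₂⟩ := hv.exists_integralCurve_short (γ₁ (n * h))
      obtain ⟨γ, hγ, hd⟩ := exists_integralCurve_concat (by positivity) hpos.le h₁ h₂ h0'
      refine ⟨γ, hγ.trans h0, ?_⟩
      have : ((n + 1 : ℕ) : ℝ) * h = n * h + h := by push_cast; ring
      rwa [this]
  obtain ⟨n, hn⟩ := exists_nat_ge (T / h)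
  have hT : Icc 0 T ⊆ Icc 0 (n * h) := Icc_subset_Icc_right ((div_le_iff₀ hpos).1 hn)
  obtain ⟨γ, h0, hd⟩ := key n
  exact ⟨γ, h0, fun t ht => (hd t (hT ht)).mono hT⟩

end LipschitzWith

/-! ### Existence and uniqueness of the attack path -/

section GradientFlow

variable {d : ℕ} {X : Set (EuclideanSpace ℝ (Fin d))} {R : EuclideanSpace ℝ (Fin d) → ℝ} {T : ℝ}
  {x₀ : EuclideanSpace ℝ (Fin d)}

lemma IsGradientFlowOn.eqOn (hR : HasLipschitzGradientOn R X)
    {γ γ' : ℝ → EuclideanSpace ℝ (Fin d)} (h : IsGradientFlowOn X R T x₀ γ)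
    (h' : IsGradientFlowOn X R T x₀ γ') : EqOn γ' γ (Icc 0 T) := by
  obtain ⟨-, L, hL⟩ := hR
  have right {α : ℝ → EuclideanSpace ℝ (Fin d)} (hα : IsGradientFlowOn X R T x₀ α) :
      ∀ t ∈ Ico 0 T, HasDerivWithinAt α (gradientWithin R X (α t)) (Ici t) t := fun t ht =>
    (hα.ode t (Ico_subset_Icc_self ht)).mono_of_mem_nhdsWithin <|
      Filter.mem_of_superset (Icc_mem_nhdsGE ht.2) (Icc_subset_Icc_left ht.1)
  have cont {α : ℝ → EuclideanSpace ℝ (Fin d)} (hα : IsGradientFlowOn X R T x₀ α) :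
      ContinuousOn α (Icc 0 T) := fun t ht => (hα.ode t ht).continuousWithinAt
  -- The field is Lipschitz only on `X`, so both paths must remain there.
  exact ODE_solution_unique_of_mem_Icc_right (v := fun _ => gradientWithin R X) (s := fun _ => X)
    (fun _ _ => hL) (cont h') (right h') (fun t ht => h'.mem t (Ico_subset_Icc_self ht))
    (cont h) (right h) (fun t ht => h.mem t (Ico_subset_Icc_self ht))
    (h'.initial.trans h.initial.symm)

lemma HasLipschitzGradientOn.exists_isGradientFlowOn_univ (hR : HasLipschitzGradientOn R univ) :
    ∃ γ, IsGradientFlowOn univ R T x₀ γ := by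
  obtain ⟨-, L, hL⟩ := hR
  obtain ⟨γ, h0, hd⟩ := (lipschitzOnWith_univ.1 hL).exists_integralCurve x₀ T
  exact ⟨γ, h0, fun _ _ => mem_univ _, hd⟩

end GradientFlow

/-- Reduces consistency of the empirical variance to the strong law for `r` and `r ^ 2`. -/
lemma empVar_eq {S : Type*} {r : S → ℝ} {z : ℕ → S} {n : ℕ} (hn : 2 ≤ n) :
    empVar r z n = (n / ((n : ℝ) - 1)) *
      ((∑ i ∈ Finset.range n, r (z i) ^ 2) / n - ((∑ i ∈ Finset.range n, r (z i)) / n) ^ 2) := by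
  have h2 : (2 : ℝ) ≤ n := by exact_mod_cast hn
  have h0 : (n : ℝ) ≠ 0 := by positivity
  have h1 : (n : ℝ) - 1 ≠ 0 := by linarith
  simp only [empVar, empMean, sub_sq, Finset.sum_add_distrib, Finset.sum_sub_distrib,
    ← Finset.sum_mul, ← Finset.mul_sum, Finset.sum_const, Finset.card_range, nsmul_eq_mul]
  field_simp
  ring

/-! ### Limit theory for a fixed model -/

section Studentized

variable {S Ω : Type*} [MeasurableSpace S] [MeasurableSpace Ω]

lemma measurable_empMean {r : S → ℝ} (hr : Measurable r) (n : ℕ) :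
    Measurable fun z : ℕ → S => empMean r z n := by
  unfold empMean
  fun_prop

lemma measurable_empVar {r : S → ℝ} (hr : Measurable r) (n : ℕ) :
    Measurable fun z : ℕ → S => empVar r z n := by
  have := measurable_empMean hr n
  unfold empVar
  fun_prop

/-- The studentized mean is jointly measurable in a parameter of `r` and in the data. -/
lemma measurable_studentizedMean {Θ : Type*} [MeasurableSpace Θ] {P : Measure S} [SFinite P]
    {g : Θ × S → ℝ} (hg : Measurable g) (n : ℕ) :
    Measurable fun p : Θ × (ℕ → S) => studentizedMean P (fun s => g (p.1, s)) p.2 n := by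
  have hI : Measurable fun θ => ∫ s, g (θ, s) ∂P :=
    hg.stronglyMeasurable.integral_prod_right'.measurable
  have hI' : Measurable fun p : Θ × (ℕ → S) => ∫ s, g (p.1, s) ∂P := hI.comp measurable_fst
  unfold studentizedMean empVar empMean
  fun_prop

variable {μ : Measure Ω} {P : Measure S} [IsProbabilityMeasure P]
  {Z : ℕ → Ω → S} {r : S → ℝ}

/-- The empirical variance of i.i.d. data is strongly consistent. -/
lemma tendsto_empVar_ae (hZ_law : ∀ i, HasLaw (Z i) P μ) (hZ_indep : iIndepFun Z μ)
    (hr : Measurable r) (hr2 : MemLp r 2 P) :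
    ∀ᵐ ω ∂μ, Tendsto (fun n => empVar r (fun i => Z i ω) n) atTop (𝓝 Var[r; P]) := by
  have hid : ∀ i, IdentDistrib (Z i) (Z 0) μ μ := fun i => (hZ_law i).identDistrib (hZ_law 0)
  have slln {u : S → ℝ} (hu : Measurable u) (hi : Integrable u P) : ∀ᵐ ω ∂μ,
      Tendsto (fun n : ℕ => (∑ i ∈ Finset.range n, u (Z i ω)) / n) atTop (𝓝 (∫ s, u s ∂P)) := by
    have h := strong_law_ae_real (μ := μ) (fun i ω => u (Z i ω))
      (((hZ_law 0).map_eq ▸ hi).comp_aemeasurable (hZ_law 0).aemeasurable)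
      (fun i j hij => (hZ_indep.indepFun hij).comp hu hu) (fun i => (hid i).comp hu)
    have hl := (hZ_law 0).integral_comp (X := Z 0) hu.aestronglyMeasurable
    simp only [Function.comp_def] at hl
    rwa [hl] at h
  have hint : Integrable r P := hr2.integrable (by norm_num)
  filter_upwards [slln hr hint, slln (hr.pow_const 2) hr2.integrable_sq] with ω h1 h2
  have h3 : Tendsto (fun n : ℕ => (n : ℝ) / ((n : ℝ) - 1)) atTop (𝓝 1) := by
    simpa [sub_eq_add_neg] using tendsto_natCast_div_add_atTop (𝕜 := ℝ) (-1)
  have h4 := h3.mul (h2.sub (h1.pow 2))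
  rw [variance_eq_sub hr2]
  simp only [one_mul] at h4
  refine h4.congr' ?_
  filter_upwards [eventually_ge_atTop 2] with n hn using (empVar_eq hn).symm

/-- **Central limit theorem** for the studentized mean of i.i.d. data. -/
theorem tendstoInDistribution_studentizedMean [IsProbabilityMeasure μ]
    (hZ_law : ∀ i, HasLaw (Z i) P μ)
    (hZ_indep : iIndepFun Z μ) (hr : Measurable r) (hr2 : MemLp r 2 P) (hvar : 0 < Var[r; P]) :
    TendstoInDistribution (fun (n : ℕ) ω => studentizedMean P r (fun i => Z i ω) n)
      atTop (id : ℝ → ℝ) (fun _ => μ) (gaussianReal 0 1) := by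
  have hid : ∀ i, IdentDistrib (Z i) (Z 0) μ μ := fun i => (hZ_law i).identDistrib (hZ_law 0)
  have hZm : ∀ i, AEMeasurable (Z i) μ := fun i => (hZ_law i).aemeasurable
  set m : ℝ := ∫ s, r s ∂P with hm
  set σ : ℝ := √Var[r; P] with hσ
  have hσpos : 0 < σ := Real.sqrt_pos.2 hvar
  have hint : Integrable r P := hr2.integrable (by norm_num)
  set u : S → ℝ := fun s => (r s - m) / σ with hu
  have hum : Measurable u := by fun_prop
  have hclt : TendstoInDistribution
      (fun (n : ℕ) ω => (√n)⁻¹ * ∑ k ∈ Finset.range n, u (Z k ω)) atTop (id : ℝ → ℝ)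
      (fun _ => μ) (gaussianReal 0 1) := by
    refine tendstoInDistribution_inv_sqrt_mul_sum (X := fun k ω => u (Z k ω)) HasLaw.id ?_ ?_
      (hZ_indep.comp (fun _ => u) (fun _ => hum)) (fun i => (hid i).comp hum)
    · have h := (hZ_law 0).integral_comp (X := Z 0) hum.aestronglyMeasurable
      simp only [Function.comp_def] at h
      rw [h, hu, integral_div, integral_sub hint (by simp)]
      simp [hm]
    · have h := (hZ_law 0).integral_comp (X := Z 0) (hum.pow_const 2).aestronglyMeasurable
      simp only [Function.comp_def] at h
      simp only [Pi.pow_apply]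
      rw [h]
      simp only [hu, div_pow]
      rw [integral_div, ← variance_eq_integral hr.aemeasurable, hσ, Real.sq_sqrt hvar.le,
        div_self hvar.ne']
  have hW : AEMeasurable (fun ω i => Z i ω) μ := aemeasurable_pi_iff.2 hZm
  have hratio_meas : ∀ n : ℕ,
      AEMeasurable (fun ω => σ * (√(empVar r (fun i => Z i ω) n))⁻¹) μ := fun n =>
    (((measurable_empVar hr n).sqrt.inv.const_mul σ).comp_aemeasurable hW)
  -- Slutsky: the studentized mean is the standardized sum times `σ / V_n`, and this factor tends to
  -- 1.
  have hratio : TendstoInMeasure μ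
      (fun (n : ℕ) ω => σ * (√(empVar r (fun i => Z i ω) n))⁻¹) atTop (fun _ => (1 : ℝ)) := by
    refine tendstoInMeasure_of_tendsto_ae (fun n => (hratio_meas n).aestronglyMeasurable) ?_
    filter_upwards [tendsto_empVar_ae hZ_law hZ_indep hr hr2] with ω hω
    have := ((hω.sqrt).inv₀ hσpos.ne').const_mul σ
    rwa [mul_inv_cancel₀ hσpos.ne'] at this
  have hprod := hclt.continuous_comp_prodMk_of_tendstoInMeasure_const
    (g := fun p : ℝ × ℝ => p.1 * p.2) (by fun_prop) hratio hratio_meas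
  simp only [id, mul_one] at hprod
  refine hprod.congr (fun n => .of_forall fun ω => ?_) .rfl
  rcases eq_or_ne n 0 with rfl | hn
  · simp [studentizedMean]
  have hn0 : (n : ℝ) ≠ 0 := by exact_mod_cast hn
  have hs : √(n : ℝ) ≠ 0 := by positivity
  have hss : √(n : ℝ) ^ 2 = n := Real.sq_sqrt (by positivity)
  simp only [hu, studentizedMean, empMean, ← hm, ← Finset.sum_div, Finset.sum_sub_distrib,
    Finset.sum_const, Finset.card_range, nsmul_eq_mul]
  -- The identity is linear in `V_n⁻¹`, so the case `V_n = 0` needs no separate treatment.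
  generalize (√(empVar r (fun i => Z i ω) n))⁻¹ = c
  field_simp
  rw [hss]

end Studentized

/-! ### Passage to a random model -/

/-- If `G n (θ, W)` converges in distribution for almost every fixed `θ`, to a limit that does not
depend on `θ`, then so does `G n (M, W)` for a random `M` that is independent of `W`. -/
theorem tendstoInDistribution_of_ae_of_indepFun {Θ S Ω Ω' : Type*}
    [MeasurableSpace Θ] [MeasurableSpace S] [MeasurableSpace Ω] [MeasurableSpace Ω']
    {μ : Measure Ω} [IsProbabilityMeasure μ] {μ' : Measure Ω'} [IsProbabilityMeasure μ']
    {Q : Measure Θ} [IsProbabilityMeasure Q] {M : Ω → Θ} {W : Ω → S} {N : Ω' → ℝ}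
    {G : ℕ → Θ × S → ℝ} (hG : ∀ n, Measurable (G n)) (hM : HasLaw M Q μ)
    (hW : AEMeasurable W μ) (hMW : IndepFun M W μ)
    (h : ∀ᵐ θ ∂Q, TendstoInDistribution (fun n ω => G n (θ, W ω)) atTop N (fun _ => μ) μ') :
    TendstoInDistribution (fun n ω => G n (M ω, W ω)) atTop N (fun _ => μ) μ' := by
  have hpair : AEMeasurable (fun ω => (M ω, W ω)) μ := hM.aemeasurable.prodMk hW
  have hN : AEMeasurable N μ' := h.exists.choose_spec.aemeasurable_limit
  have hmeas : ∀ n, AEMeasurable (fun ω => G n (M ω, W ω)) μ := fun n =>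
    (hG n).comp_aemeasurable hpair
  have : IsProbabilityMeasure (μ.map W) := Measure.isProbabilityMeasure_map hW
  have hlaw : μ.map (fun ω => (M ω, W ω)) = Q.prod (μ.map W) := by
    rw [hMW.map_prod_eq_prod_map_map hM.aemeasurable hW, hM.map_eq]
  refine ⟨hmeas, hN, ProbabilityMeasure.tendsto_iff_forall_integral_tendsto.2 fun φ => ?_⟩
  have hφ : ∀ n, Measurable fun p => φ (G n p) := fun n => φ.continuous.measurable.comp (hG n)
  have hint : ∀ n, Integrable (fun p => φ (G n p)) (Q.prod (μ.map W)) := fun n =>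
    Integrable.of_bound (hφ n).aestronglyMeasurable ‖φ‖ (.of_forall fun p => φ.norm_coe_le_norm _)
  -- By independence the law of `(M, W)` is a product, so Fubini lets the model be frozen in the
  -- inner integral.
  have hjoint : ∀ n, ∫ x, φ x ∂(μ.map fun ω => G n (M ω, W ω)) =
      ∫ θ, ∫ ω, φ (G n (θ, W ω)) ∂μ ∂Q := fun n => by
    rw [integral_map (hmeas n) φ.continuous.aestronglyMeasurable,
      ← integral_map (f := fun p => φ (G n p)) hpair (hφ n).aestronglyMeasurable, hlaw,
      integral_prod _ (hint n)]
    refine integral_congr_ae (.of_forall fun θ => ?_)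
    exact integral_map (f := fun s => φ (G n (θ, s))) hW
      ((hφ n).comp measurable_prodMk_left).aestronglyMeasurable
  simp only [ProbabilityMeasure.coe_mk, hjoint]
  have hconst : ∫ x, φ x ∂(μ'.map N) = ∫ _θ : Θ, (∫ x, φ x ∂(μ'.map N)) ∂Q := by simp
  rw [hconst]
  refine tendsto_integral_of_dominated_convergence (fun _ => ‖φ‖) (fun n => ?_)
    (integrable_const _) (fun n => .of_forall fun θ => ?_) ?_
  · have := (hint n).aestronglyMeasurable.integral_prod_right'
    refine this.congr (.of_forall fun θ => ?_)
    exact integral_map (f := fun s => φ (G n (θ, s))) hW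
      ((hφ n).comp measurable_prodMk_left).aestronglyMeasurable
  · simpa using norm_integral_le_of_norm_le_const (μ := μ)
      (.of_forall fun ω => φ.norm_coe_le_norm (G n (θ, W ω)))
  · filter_upwards [h] with θ hθ
    have := ProbabilityMeasure.tendsto_iff_forall_integral_tendsto.1 hθ.tendsto φ
    simp only [ProbabilityMeasure.coe_mk] at this
    refine this.congr fun n => ?_
    exact integral_map (hθ.forall_aemeasurable n) φ.continuous.aestronglyMeasurable

theorem theorem2 {d : ℕ} {Y Θ Ω : Type*}
    [MeasurableSpace Y] [MeasurableSpace Θ] [MeasurableSpace Ω]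
    -- the feature space, the loss, the fair metric, the penalty parameter, the stopping time
    (X : Set (EuclideanSpace ℝ (Fin d))) (hX : UniqueDiffOn ℝ X)
    (ℓ : Y → Y → ℝ)
    (dX : EuclideanSpace ℝ (Fin d) → EuclideanSpace ℝ (Fin d) → ℝ)
    (lam T : ℝ) (hT : 0 < T)
    -- the class of ML models, indexed by `Θ`
    (f : Θ → EuclideanSpace ℝ (Fin d) → Y)
    -- the i.i.d. audit data `Z i = (x_i, y_i)` with law `P`, a distribution on `X × Y`
    (μ : Measure Ω) [IsProbabilityMeasure μ]
    (P : Measure (EuclideanSpace ℝ (Fin d) × Y)) [IsProbabilityMeasure P]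
    (hP : ∀ᵐ z ∂P, z.1 ∈ X)
    (Z : ℕ → Ω → EuclideanSpace ℝ (Fin d) × Y)
    (hZ_law : ∀ i, HasLaw (Z i) P μ) (hZ_indep : iIndepFun Z μ)
    -- the (random) model `f (M ω)`, independent of the audit data, and its law `Q`
    (Q : Measure Θ) [IsProbabilityMeasure Q]
    (M : Ω → Θ) (hM_law : HasLaw M Q μ)
    (hM_indep : IndepFun M (fun ω i => Z i ω) μ)
    -- the gradient of the regularized loss exists and is Lipschitz
    (hLip : ∀ᵐ θ ∂Q, ∀ z : EuclideanSpace ℝ (Fin d) × Y, z.1 ∈ X →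
      HasLipschitzGradientOn (regLoss ℓ dX lam (f θ) z) X)
    -- if the feature space is not all of `ℝᵈ`, then the gradient flow attack does not leave it
    (hStay : X ≠ univ → ∀ᵐ θ ∂Q, ∀ z : EuclideanSpace ℝ (Fin d) × Y, z.1 ∈ X →
      ∃ γ, IsGradientFlowOn X (regLoss ℓ dX lam (f θ) z) T z.1 γ)
    -- the loss ratio is well defined and measurable, its first two moments are finite, and it
    -- is not almost surely constant
    (hne : ∀ᵐ θ ∂Q, ∀ᵐ z ∂P, ℓ (f θ z.1) z.2 ≠ 0)
    (hmeas : AEMeasurable (fun p : Θ × (EuclideanSpace ℝ (Fin d) × Y) =>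
      lossRatio X ℓ dX lam T (f p.1) p.2) (Q.prod P))
    (hmom : ∀ᵐ θ ∂Q, Integrable (lossRatio X ℓ dX lam T (f θ)) P ∧
      Integrable (fun z => lossRatio X ℓ dX lam T (f θ) z ^ 2) P)
    (hvar : ∀ᵐ θ ∂Q, 0 < Var[lossRatio X ℓ dX lam T (f θ); P]) :
    -- the gradient flow attack has exactly one solution path, and the unfair map is its endpoint
    (∀ᵐ θ ∂Q, ∀ z : EuclideanSpace ℝ (Fin d) × Y, z.1 ∈ X →
      ∃ γ, IsGradientFlowOn X (regLoss ℓ dX lam (f θ) z) T z.1 γ ∧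
        (∀ γ', IsGradientFlowOn X (regLoss ℓ dX lam (f θ) z) T z.1 γ' → EqOn γ' γ (Icc 0 T)) ∧
        unfairMap X ℓ dX lam T (f θ) z = γ T) ∧
    -- the studentized mean converges in distribution to `N(0, 1)`
    TendstoInDistribution
      (fun (n : ℕ) (ω : Ω) =>
        studentizedMean P (lossRatio X ℓ dX lam T (f (M ω))) (fun i => Z i ω) n)
      atTop (id : ℝ → ℝ) (fun _ => μ) (gaussianReal 0 1) := by
  refine ⟨?_, ?_⟩
  · have hex : ∀ᵐ θ ∂Q, ∀ z : EuclideanSpace ℝ (Fin d) × Y, z.1 ∈ X →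
        ∃ γ, IsGradientFlowOn X (regLoss ℓ dX lam (f θ) z) T z.1 γ := by
      by_cases hu : X = univ
      · subst hu
        filter_upwards [hLip] with θ hθ z hz using (hθ z hz).exists_isGradientFlowOn_univ
      · exact hStay hu
    filter_upwards [hLip, hex] with θ hθ hexθ z hz
    have h := hexθ z hz
    refine ⟨h.choose, h.choose_spec, fun γ' h' => h.choose_spec.eqOn (hθ z hz) h', ?_⟩
    rw [unfairMap, dif_pos h]
  · set r : Θ × (EuclideanSpace ℝ (Fin d) × Y) → ℝ :=
      fun p => lossRatio X ℓ dX lam T (f p.1) p.2 with hr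
    -- The loss ratio is only a.e. measurable in model and sample jointly, so the limit is proved
    -- for a measurable version `g` and transferred back.
    obtain ⟨g, hg, hrg_prod⟩ := hmeas
    have hrg : ∀ᵐ θ ∂Q, (fun z => r (θ, z)) =ᵐ[P] fun z => g (θ, z) :=
      Measure.ae_ae_of_ae_prod hrg_prod
    have hW : AEMeasurable (fun ω i => Z i ω) μ :=
      aemeasurable_pi_iff.2 fun i => (hZ_law i).aemeasurable
    have hconv : TendstoInDistribution (fun (n : ℕ) ω =>
        studentizedMean P (fun z => g (M ω, z)) (fun i => Z i ω) n)
        atTop (id : ℝ → ℝ) (fun _ => μ) (gaussianReal 0 1) := by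
      refine tendstoInDistribution_of_ae_of_indepFun
        (G := fun n p => studentizedMean P (fun z => g (p.1, z)) p.2 n)
        (measurable_studentizedMean hg) hM_law hW hM_indep ?_
      filter_upwards [hrg, hmom, hvar] with θ h1 h2 h3
      have hgθ : Measurable fun z => g (θ, z) := hg.comp measurable_prodMk_left
      have hL2 : MemLp (fun z => r (θ, z)) 2 P :=
        (memLp_two_iff_integrable_sq h2.1.aestronglyMeasurable).2 h2.2
      refine tendstoInDistribution_studentizedMean hZ_law hZ_indep hgθ (hL2.ae_eq h1) ?_
      rwa [← variance_congr h1]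
    have hint : ∀ᵐ ω ∂μ, ∫ z, r (M ω, z) ∂P = ∫ z, g (M ω, z) ∂P := by
      have : ∀ᵐ θ ∂(μ.map M), (fun z => r (θ, z)) =ᵐ[P] fun z => g (θ, z) := by
        rwa [hM_law.map_eq]
      filter_upwards [ae_of_ae_map hM_law.aemeasurable this] with ω hω using integral_congr_ae hω
    -- Each pair `(M, Z i)` has law `Q.prod P`, so almost surely no data point meets the null set
    -- where `r` and `g` differ.
    have hval : ∀ᵐ ω ∂μ, ∀ i, r (M ω, Z i ω) = g (M ω, Z i ω) := by
      refine ae_all_iff.2 fun i => ?_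
      have hi : IndepFun M (Z i) μ := hM_indep.comp measurable_id (measurable_pi_apply i)
      have hlaw : μ.map (fun ω => (M ω, Z i ω)) = Q.prod P := by
        rw [hi.map_prod_eq_prod_map_map hM_law.aemeasurable (hZ_law i).aemeasurable,
          hM_law.map_eq, (hZ_law i).map_eq]
      exact ae_of_ae_map (hM_law.aemeasurable.prodMk (hZ_law i).aemeasurable)
        (by rw [hlaw]; exact hrg_prod)
    refine hconv.congr (fun n => ?_) .rfl
    filter_upwards [hint, hval] with ω h1 h2
    simp only [hr] at h1 h2
    simp only [studentizedMean, empVar, empMean, h1, h2]
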